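/- Let $\alpha>0$, and let $G=(V,E)$ be a simple, undirected, locally finite, connected graph that is an antitree with root $v\in V$, i.e. for every vertex $w\neq v$, with $n=d_G(v,w)$, the set of neighbours of $w$ is $S_{n-1}\cup S_{n+1}$, where $S_k=\{u\in V: d_G(v,u)=k\}$ and $d_G$ is the graph distance. Assume that the spheres have the sizes $|S_0|=1$ and $|S_n|=\lfloor n^\alpha\rfloor$ for $n\ge 1$. Let $\mathcal{A}_{G,\circ}$ be the operator in the complex Hilbert space $\ell^2(V)$ defined on the finitely supported functions by $(\mathcal{A}_{G,\circ}f)(x)=\sum_{y\sim x}f(y)$, and let $\mathcal{A}_G$ be its closure. For a densely defined symmetric operator $T$ let $\eta_\pm(T)=\dim\ker(T^*\mp \mathrm{i})\in\mathbb{N}\cup\{\infty\}$, and write $\eta(T)=n$ if $\eta_+(T)=\eta_-(T)=n$. Then \[ \eta(\mathcal{A}_G)=\begin{cases}0, & \text{if } 0<\alpha\le 1,\\ 1, & \text{if } \alpha>1.\end{cases} \] In the case $0<\alpha\le1$, $\mathcal{A}_{G,\circ}$ is essentially self-adjoint, i.e. its closure $\mathcal{A}_G$ is self-adjoint. -/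

import Mathlib

open scoped LinearPMap

/-! ### Deficiency indices of operators on a complex Hilbert space -/

section Deficiency

variable {H : Type*} [NormedAddCommGroup H] [InnerProductSpace ℂ H] [CompleteSpace H]

/-- The kernel of `T† - z`, for a densely defined operator `T`, inside the domain of `T†`. -/
noncomputable def LinearPMap.deficiencySpace (T : H →ₗ.[ℂ] H) (z : ℂ) : Submodule ℂ T†.domain :=
  LinearMap.ker (T†.toFun - z • T†.domain.subtype)

/-- The deficiency index `η₊(T) = dim ker (T† - i)`, in `ℕ ∪ {∞}`. -/
noncomputable def LinearPMap.deficiencyIndexPlus (T : H →ₗ.[ℂ] H) : ℕ∞ :=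
  Cardinal.toENat (Module.rank ℂ (T.deficiencySpace Complex.I))

/-- The deficiency index `η₋(T) = dim ker (T† + i)`, in `ℕ ∪ {∞}`. -/
noncomputable def LinearPMap.deficiencyIndexMinus (T : H →ₗ.[ℂ] H) : ℕ∞ :=
  Cardinal.toENat (Module.rank ℂ (T.deficiencySpace (-Complex.I)))

/-- `η(T) = n`: both deficiency indices of `T` exist as a common value, and it equals `n`. -/
def LinearPMap.HasDeficiencyIndex (T : H →ₗ.[ℂ] H) (n : ℕ∞) : Prop :=
  T.deficiencyIndexPlus = n ∧ T.deficiencyIndexMinus = n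

/-- An operator is essentially self-adjoint if it is closable and its closure is self-adjoint. -/
def LinearPMap.IsEssentiallySelfAdjoint (T : H →ₗ.[ℂ] H) : Prop :=
  T.IsClosable ∧ IsSelfAdjoint T.closure

end Deficiency

/-! ### The adjacency operator of a locally finite graph -/

namespace SimpleGraph

/-- The finitely supported functions, as a subspace of `ℓ²(V)`. -/
def finSupp (V : Type*) : Submodule ℂ (lp (fun _ : V => ℂ) 2) where
  carrier := {f | (Function.support (f : V → ℂ)).Finite}
  zero_mem' := by
    have h : Function.support ((0 : lp (fun _ : V => ℂ) 2) : V → ℂ) = ∅ := by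
      rw [lp.coeFn_zero]; exact Function.support_zero
    rw [Set.mem_ofPred_eq, h]
    exact Set.finite_empty
  add_mem' {f g} hf hg := (Set.Finite.union hf hg).subset (by
    rw [lp.coeFn_add]; exact Function.support_add _ _)
  smul_mem' c f hf := Set.Finite.subset hf (by
    rw [lp.coeFn_smul]; exact Function.support_const_smul_subset c _)

variable {V : Type*} (G : SimpleGraph V) [G.LocallyFinite]

/-- `(A f)(x) = ∑ f(y)`, the sum being over the neighbours `y` of `x`. -/
def adjacencySum (f : V → ℂ) (x : V) : ℂ :=
  ∑ y ∈ G.neighborFinset x, f y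

theorem finite_support_adjacencySum {f : V → ℂ} (hf : (Function.support f).Finite) :
    (Function.support (G.adjacencySum f)).Finite := by
  refine (hf.biUnion fun y _ => (G.neighborFinset y).finite_toSet).subset ?_
  intro x hx
  obtain ⟨y, hy, hne⟩ := Finset.exists_ne_zero_of_sum_ne_zero hx
  rw [mem_neighborFinset] at hy
  simp only [Set.mem_iUnion]
  exact ⟨y, hne, by simpa using hy.symm⟩

theorem memℓp_adjacencySum {f : V → ℂ} (hf : (Function.support f).Finite) :
    Memℓp (G.adjacencySum f) 2 :=
  (memℓp_zero (G.finite_support_adjacencySum hf)).of_exponent_ge (zero_le)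

/-- The adjacency matrix as an operator on `ℓ²(V)` with domain the finitely supported functions. -/
noncomputable def adjacencyOperatorCore : lp (fun _ : V => ℂ) 2 →ₗ.[ℂ] lp (fun _ : V => ℂ) 2 where
  domain := finSupp V
  toFun :=
    { toFun := fun f => ⟨G.adjacencySum (f : lp (fun _ : V => ℂ) 2), G.memℓp_adjacencySum f.2⟩
      map_add' := fun f g => by
        ext x
        exact Finset.sum_add_distrib
      map_smul' := fun c f => by
        ext x
        exact (Finset.mul_sum _ _ _).symm }

/-- The adjacency matrix `𝒜_G`: the closure of its restriction to finitely supported functions. -/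
noncomputable def adjacencyOperator : lp (fun _ : V => ℂ) 2 →ₗ.[ℂ] lp (fun _ : V => ℂ) 2 :=
  G.adjacencyOperatorCore.closure

theorem dense_finSupp (V : Type*) : Dense (finSupp V : Set (lp (fun _ : V => ℂ) 2)) := by
  classical
  intro f
  refine mem_closure_of_tendsto (lp.hasSum_single (by norm_num) f) (Filter.Eventually.of_forall ?_)
  intro s
  refine Submodule.sum_mem _ fun i _ => ?_
  refine (Set.finite_singleton i).subset ?_
  rw [lp.coeFn_single]
  exact Pi.support_single_subset

/-- The adjacency matrix is symmetric on finitely supported functions. -/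
theorem adjacencyOperatorCore_isFormalAdjoint :
    G.adjacencyOperatorCore.IsFormalAdjoint G.adjacencyOperatorCore := by
  classical
  intro f g
  have hf : (Function.support ((f : lp (fun _ : V => ℂ) 2) : V → ℂ)).Finite := f.2
  have hg : (Function.support ((g : lp (fun _ : V => ℂ) 2) : V → ℂ)).Finite := g.2
  have h1 : ∀ x, (G.adjacencyOperatorCore f : V → ℂ) x =
    ∑ y ∈ hf.toFinset, if G.Adj x y then (f : lp (fun _ : V => ℂ) 2) y else 0 := by
    intro x
    change ∑ y ∈ G.neighborFinset x, (f : lp (fun _ : V => ℂ) 2) y = _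
    rw [← Finset.sum_filter]
    refine (Finset.sum_subset_zero_on_sdiff ?_ ?_ fun _ _ => rfl).symm
    · intro y; simp
    · intro y; simp +contextual
  have h2 : ∀ x, (G.adjacencyOperatorCore g : V → ℂ) x =
    ∑ y ∈ hg.toFinset, if G.Adj x y then (g : lp (fun _ : V => ℂ) 2) y else 0 := by
    intro x
    change ∑ y ∈ G.neighborFinset x, (g : lp (fun _ : V => ℂ) 2) y = _
    rw [← Finset.sum_filter]
    refine (Finset.sum_subset_zero_on_sdiff ?_ ?_ fun _ _ => rfl).symm
    · intro y; simp
    · intro y; simp +contextual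
  rw [lp.inner_eq_tsum, lp.inner_eq_tsum, tsum_eq_sum (s := hg.toFinset), tsum_eq_sum (s := hf.toFinset)]
  · simp only [h1, h2, RCLike.inner_apply, map_sum, Finset.sum_mul, Finset.mul_sum]
    rw [Finset.sum_comm]
    refine Finset.sum_congr rfl fun y _ => Finset.sum_congr rfl fun x _ => ?_
    by_cases h : G.Adj x y
    · simp [h, h.symm]
    · have h' : ¬ G.Adj y x := fun h' => h h'.symm
      simp [h, h']
  · intro x hx
    have : (f : lp (fun _ : V => ℂ) 2) x = 0 := by simpa using hx
    simp [this]
  · intro x hx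
    have : (g : lp (fun _ : V => ℂ) 2) x = 0 := by simpa using hx
    simp [this]

/-- The adjacency matrix is closable, so that `adjacencyOperator` is its closure. -/
theorem adjacencyOperatorCore_isClosable : G.adjacencyOperatorCore.IsClosable := by
  have hd : Dense (G.adjacencyOperatorCore.domain : Set (lp (fun _ : V => ℂ) 2)) :=
    dense_finSupp V
  have hle : G.adjacencyOperatorCore ≤ G.adjacencyOperatorCore† :=
    G.adjacencyOperatorCore_isFormalAdjoint.le_adjoint hd
  have hc : G.adjacencyOperatorCore†.IsClosed := LinearPMap.adjoint_isClosed hd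
  exact hc.isClosable.leIsClosable hle

end SimpleGraph

/-! ### Antitrees -/

/-- The sphere of radius `n` around `v` in the graph metric of a connected graph. -/
def SimpleGraph.sphere {V : Type*} (G : SimpleGraph V) (v : V) (n : ℕ) : Set V :=
  {w | G.dist v w = n}

/-- The connected graph `G` is an antitree with root `v`: the neighbours of a vertex `w ≠ v` at
distance `n` from `v` are exactly the vertices at distance `n - 1` or `n + 1` from `v`. -/
structure SimpleGraph.IsAntitree {V : Type*} (G : SimpleGraph V) (v : V) : Prop where
  connected : G.Connected
  neighborSet_eq : ∀ w, w ≠ v →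
    G.neighborSet w = G.sphere v (G.dist v w - 1) ∪ G.sphere v (G.dist v w + 1)

/-- The sequence `s₀ = 1`, `sₙ = ⌊n ^ α⌋` for `n ≥ 1`. -/
noncomputable def powerSphereSize (α : ℝ) (n : ℕ) : ℕ :=
  if n = 0 then 1 else ⌊(n : ℝ) ^ α⌋₊

/-! The adjoint of the adjacency operator acts by neighbour sums on its maximal domain in ℓ², so the
deficiency space at `z` consists of the ℓ² solutions of `Af = zf`. On an antitree `(Af)(x)` depends
only on the distance of `x` from the root; hence for `z ≠ 0` every solution is radial and determined
by its value at the root. Its sphere sums `pₙ`, normalised by `p₀ = 1`, satisfy `pₙ₊₂ = (z / sₙ₊₁)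
pₙ₊₁ - pₙ`, and its squared norm is `∑ |pₙ|² / sₙ`. The deficiency index is therefore 1 or 0
according to whether this series converges at `z = ±i`.

If `α ≤ 1`, a Wronskian-type bound `|pₙ| |pₙ₊₁| ≥ |Im z|` together with `sₙ ≤ n + 1` forces
divergence by comparison with the harmonic series. If `α > 1`, then `∑ 1 / sₙ < ∞`, so `pₙ` is
bounded and the series converges. Self-adjointness for `α ≤ 1` follows from von Neumann's criterion.
-/

namespace LinearPMap

/-! ### Von Neumann's criterion for self-adjointness. -/

section Hilbert

variable {H : Type*} [NormedAddCommGroup H] [InnerProductSpace ℂ H]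

/-- Symmetry makes `⟨Tx, x⟩` real, so the cross term `2 Re (i⟨Tx, x⟩)` vanishes. -/
theorem norm_sq_add_I_smul_of_isFormalAdjoint {T : H →ₗ.[ℂ] H} (hT : T.IsFormalAdjoint T)
    (x : T.domain) : ‖T x + Complex.I • (x : H)‖ ^ 2 = ‖T x‖ ^ 2 + ‖(x : H)‖ ^ 2 := by
  have him : (inner ℂ (T x) (x : H) : ℂ).im = 0 := by
    rw [← Complex.conj_eq_iff_im]
    exact (inner_conj_symm _ _).trans (hT x x).symm
  rw [norm_add_sq (𝕜 := ℂ), inner_smul_right, norm_smul]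
  simp [him]

variable [CompleteSpace H]

/-- The adjoint of a densely defined operator agrees with the adjoint of its closure. -/
theorem IsClosable.adjoint_closure {T : H →ₗ.[ℂ] H} (hT : T.IsClosable)
    (hd : Dense (T.domain : Set H)) : T.closure† = T† := by
  have hd' : Dense (T.closure.domain : Set H) := hd.mono T.le_closure.1
  apply eq_of_eq_graph
  rw [adjoint_graph_eq_graph_adjoint hd', adjoint_graph_eq_graph_adjoint hd,
    ← hT.graph_closure_eq_closure_graph]
  ext p
  rw [Submodule.mem_adjoint_iff, Submodule.mem_adjoint_iff]
  -- Orthogonality to a fixed pair is a closed condition, so it passes from the graph to its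
  -- closure.
  refine ⟨fun h a b hab => h a b (subset_closure hab), fun h a b hab => ?_⟩
  have hc : _root_.IsClosed {q : H × H | inner ℂ q.2 p.1 - inner ℂ q.1 p.2 = 0} :=
    isClosed_eq (by fun_prop) continuous_const
  exact closure_minimal (s := (T.graph : Set (H × H))) (fun q hq => h q.1 q.2 hq) hc hab

theorem mem_deficiencySpace {T : H →ₗ.[ℂ] H} {z : ℂ} {y : T†.domain} :
    y ∈ T.deficiencySpace z ↔ T† y = z • (y : H) := by
  rw [deficiencySpace, LinearMap.mem_ker, LinearMap.sub_apply, sub_eq_zero]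
  rfl

/-- A densely defined closed symmetric operator whose adjoint has no eigenvectors
for the eigenvalues `± i` is self-adjoint. -/
theorem isSelfAdjoint_of_deficiencySpace_eq_bot {T : H →ₗ.[ℂ] H}
    (hd : Dense (T.domain : Set H)) (hc : T.IsClosed) (hT : T.IsFormalAdjoint T)
    (hp : T.deficiencySpace Complex.I = ⊥) (hm : T.deficiencySpace (-Complex.I) = ⊥) :
    IsSelfAdjoint T := by
  have hle : T ≤ T† := hT.le_adjoint hd
  -- `T + i` is viewed as a bounded map on the graph, which is complete because `T` is closed. Being
  -- bounded below, it has closed range.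
  let Φ : T.graph →L[ℂ] H :=
    (ContinuousLinearMap.snd ℂ H H + Complex.I • ContinuousLinearMap.fst ℂ H H).comp
      T.graph.subtypeL
  have hΦ : ∀ x : T.domain, Φ ⟨(x, T x), T.mem_graph x⟩ = T x + Complex.I • (x : H) :=
    fun x => rfl
  have hbound : ∀ q : T.graph, ‖q‖ ≤ ‖Φ q‖ := by
    rintro ⟨⟨a, b⟩, hq⟩
    obtain ⟨x, rfl, rfl⟩ := T.mem_graph_iff.1 hq
    have h := norm_sq_add_I_smul_of_isFormalAdjoint hT x
    rw [hΦ]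
    have h1 : ‖(x : H)‖ ≤ ‖T x + Complex.I • (x : H)‖ :=
      (sq_le_sq₀ (norm_nonneg _) (norm_nonneg _)).1 (by rw [h]; exact le_add_of_nonneg_left (sq_nonneg _))
    have h2 : ‖T x‖ ≤ ‖T x + Complex.I • (x : H)‖ :=
      (sq_le_sq₀ (norm_nonneg _) (norm_nonneg _)).1 (by rw [h]; exact le_add_of_nonneg_right (sq_nonneg _))
    exact max_le h1 h2
  have hanti : AntilipschitzWith 1 Φ :=
    AddMonoidHomClass.antilipschitz_of_bound Φ fun q => by simpa using hbound q
  have : _root_.IsClosed (T.graph : Set (H × H)) := hc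
  have : CompleteSpace T.graph := this.completeSpace_coe
  have hrc : _root_.IsClosed (Set.range Φ) := hanti.isClosed_range Φ.uniformContinuous
  have hrange : Φ.range = ⊤ := by
    have : CompleteSpace Φ.range := _root_.IsClosed.completeSpace_coe (hs := hrc)
    rw [← Submodule.orthogonal_eq_bot_iff, Submodule.eq_bot_iff]
    intro y hy
    -- A vector orthogonal to the range of `T + i` is an eigenvector of `T†` for `i`.
    have hy' : ∀ x : T.domain, inner ℂ (Complex.I • y) (x : H) = inner ℂ y (T x) := by
      intro x
      have h := (Submodule.mem_orthogonal' _ y).1 hy _ ⟨_, hΦ x⟩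
      rw [inner_add_right, inner_smul_right] at h
      rw [inner_smul_left, Complex.conj_I, eq_comm, ← sub_eq_zero]
      linear_combination h
    have hyd : y ∈ T†.domain := mem_adjoint_domain_of_exists y ⟨_, hy'⟩
    have hk : (⟨y, hyd⟩ : T†.domain) ∈ T.deficiencySpace Complex.I :=
      mem_deficiencySpace.2 (adjoint_apply_eq hd _ hy')
    rw [hp, Submodule.mem_bot] at hk
    exact congrArg Subtype.val hk
  rw [isSelfAdjoint_def]
  refine (eq_of_le_of_domain_eq hle (le_antisymm hle.1 fun y hy => ?_)).symm
  -- By surjectivity `(T† + i)y = (T + i)x` for some `x`; then `y - x` is an eigenvector of `T†` for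
  -- `-i`, hence zero.
  obtain ⟨⟨⟨a, b⟩, hq⟩, hx⟩ :
      (T† ⟨y, hy⟩ + Complex.I • y : H) ∈ Φ.range := hrange ▸ Submodule.mem_top
  obtain ⟨x, rfl, rfl⟩ := T.mem_graph_iff.1 hq
  have hx : T x + Complex.I • (x : H) = T† ⟨y, hy⟩ + Complex.I • y := hx
  have hxd : (x : H) ∈ T†.domain := hle.1 x.2
  have hTx : T x = T† ⟨x, hxd⟩ := hle.2 rfl
  have hk : (⟨y, hy⟩ - ⟨x, hxd⟩ : T†.domain) ∈ T.deficiencySpace (-Complex.I) := by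
    rw [mem_deficiencySpace, map_sub, ← hTx]
    rw [eq_sub_of_add_eq hx, Submodule.coe_sub, neg_smul, smul_sub]
    abel
  rw [hm, Submodule.mem_bot, sub_eq_zero] at hk
  have : y = x := congrArg Subtype.val hk
  exact this ▸ x.2

end Hilbert

end LinearPMap

/-! ### The adjoint of the adjacency operator. -/

namespace SimpleGraph

variable {V : Type*} (G : SimpleGraph V) [G.LocallyFinite]

/-- Both sums are finite because `u` has finite support, and adjacency is symmetric. The right side
is a series, not an ℓ² inner product, since `G.adjacencySum f` may fail to be in ℓ². -/
theorem inner_adjacencyOperatorCore (u : G.adjacencyOperatorCore.domain)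
    (f : lp (fun _ : V => ℂ) 2) :
    inner ℂ (G.adjacencyOperatorCore u) f =
      ∑' x, inner ℂ ((u : lp (fun _ : V => ℂ) 2) x) (G.adjacencySum f x) := by
  classical
  have hu : (Function.support ((u : lp (fun _ : V => ℂ) 2) : V → ℂ)).Finite := u.2
  let S : Finset V := hu.toFinset.biUnion fun y => G.neighborFinset y
  have h1 : ∀ x, (G.adjacencyOperatorCore u : V → ℂ) x =
      ∑ y ∈ hu.toFinset, if G.Adj x y then (u : lp (fun _ : V => ℂ) 2) y else 0 := by
    intro x
    change ∑ y ∈ G.neighborFinset x, (u : lp (fun _ : V => ℂ) 2) y = _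
    rw [← Finset.sum_filter]
    refine (Finset.sum_subset_zero_on_sdiff ?_ ?_ fun _ _ => rfl).symm
    · intro y; simp
    · intro y; simp +contextual
  have h2 : ∀ y ∈ hu.toFinset, G.adjacencySum f y = ∑ x ∈ S, if G.Adj x y then f x else 0 := by
    intro y hy
    rw [← Finset.sum_filter]
    refine Finset.sum_congr ?_ fun _ _ => rfl
    ext x
    simp only [mem_neighborFinset, Finset.mem_filter, S, Finset.mem_biUnion]
    exact ⟨fun h => ⟨⟨y, hy, h⟩, h.symm⟩, fun h => h.2.symm⟩
  rw [lp.inner_eq_tsum, tsum_eq_sum (s := S), tsum_eq_sum (s := hu.toFinset)]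
  · have h3 : ∑ y ∈ hu.toFinset, inner ℂ ((u : lp (fun _ : V => ℂ) 2) y) (G.adjacencySum f y) =
        ∑ y ∈ hu.toFinset, inner ℂ ((u : lp (fun _ : V => ℂ) 2) y)
          (∑ x ∈ S, if G.Adj x y then f x else 0) :=
      Finset.sum_congr rfl fun y hy => by rw [h2 y hy]
    rw [h3]
    simp only [h1, RCLike.inner_apply, map_sum, Finset.sum_mul, Finset.mul_sum]
    rw [Finset.sum_comm]
    refine Finset.sum_congr rfl fun y _ => Finset.sum_congr rfl fun x _ => ?_
    by_cases h : G.Adj x y <;> simp [h]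
  · intro x hx
    have : (u : lp (fun _ : V => ℂ) 2) x = 0 := by simpa using hx
    simp [this]
  · intro x hx
    rw [h1, Finset.sum_eq_zero, inner_zero_left]
    intro y hy
    rw [if_neg]
    exact fun h => hx (Finset.mem_biUnion.2 ⟨y, hy, by simpa using h.symm⟩)

/-- The adjoint of the adjacency operator acts by the adjacency sum on its maximal domain. -/
theorem mem_graph_adjoint_adjacencyOperator_iff {f g : lp (fun _ : V => ℂ) 2} :
    (f, g) ∈ G.adjacencyOperator†.graph ↔ ∀ x, G.adjacencySum f x = g x := by
  classical
  have hd : Dense (G.adjacencyOperatorCore.domain : Set (lp (fun _ : V => ℂ) 2)) :=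
    dense_finSupp V
  rw [adjacencyOperator, G.adjacencyOperatorCore_isClosable.adjoint_closure hd,
    LinearPMap.adjoint_graph_eq_graph_adjoint hd, Submodule.mem_adjoint_iff]
  constructor
  · intro h x
    -- Testing against the point mass at `x` isolates the value at `x`.
    let δ : G.adjacencyOperatorCore.domain := ⟨lp.single 2 x (1 : ℂ), by
      refine (Set.finite_singleton x).subset ?_
      rw [lp.coeFn_single]
      exact Pi.support_single_subset⟩
    have hx := h δ _ (G.adjacencyOperatorCore.mem_graph δ)
    rw [G.inner_adjacencyOperatorCore, lp.inner_single_left, tsum_eq_single x, sub_eq_zero] at hx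
    · simpa [δ] using hx
    · intro y hy
      simp [δ, lp.single_apply, hy]
  · intro h a b hab
    obtain ⟨u, rfl, rfl⟩ := LinearPMap.mem_graph_iff _ |>.1 hab
    rw [G.inner_adjacencyOperatorCore, lp.inner_eq_tsum, sub_eq_zero]
    exact tsum_congr fun x => by rw [h x]

theorem dense_adjacencyOperator_domain :
    Dense (G.adjacencyOperator.domain : Set (lp (fun _ : V => ℂ) 2)) :=
  (dense_finSupp V).mono G.adjacencyOperatorCore.le_closure.1

theorem adjacencyOperator_isFormalAdjoint :
    G.adjacencyOperator.IsFormalAdjoint G.adjacencyOperator := by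
  have hd : Dense (G.adjacencyOperatorCore.domain : Set (lp (fun _ : V => ℂ) 2)) :=
    dense_finSupp V
  have hle : G.adjacencyOperator ≤ G.adjacencyOperator† := by
    rw [adjacencyOperator, G.adjacencyOperatorCore_isClosable.adjoint_closure hd]
    have hc : G.adjacencyOperatorCore†.IsClosed := LinearPMap.adjoint_isClosed hd
    have h := hc.isClosable.closure_mono (G.adjacencyOperatorCore_isFormalAdjoint.le_adjoint hd)
    refine h.trans (LinearPMap.le_of_le_graph ?_)
    rw [← hc.isClosable.graph_closure_eq_closure_graph]
    exact hc.submodule_topologicalClosure_eq.le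
  intro x y
  have h := LinearPMap.adjoint_isFormalAdjoint G.dense_adjacencyOperator_domain
    ⟨x, hle.1 x.2⟩ y
  rwa [← hle.2 (x := x) (y := ⟨x, hle.1 x.2⟩) rfl] at h

theorem adjacencySum_eq_of_mem_deficiencySpace {z : ℂ} {y : G.adjacencyOperator†.domain}
    (hy : y ∈ G.adjacencyOperator.deficiencySpace z) (x : V) :
    G.adjacencySum (y : lp (fun _ : V => ℂ) 2) x = z * (y : lp (fun _ : V => ℂ) 2) x := by
  have h := G.mem_graph_adjoint_adjacencyOperator_iff.1 (LinearPMap.mem_graph _ y) x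
  rw [h, LinearPMap.mem_deficiencySpace.1 hy]
  rfl

theorem exists_mem_deficiencySpace {z : ℂ} {f : lp (fun _ : V => ℂ) 2}
    (hf : ∀ x, G.adjacencySum f x = z * f x) :
    ∃ y ∈ G.adjacencyOperator.deficiencySpace z, (y : lp (fun _ : V => ℂ) 2) = f := by
  have h : (f, z • f) ∈ G.adjacencyOperator†.graph :=
    G.mem_graph_adjoint_adjacencyOperator_iff.2 hf
  obtain ⟨y, rfl, hy⟩ := LinearPMap.mem_graph_iff _ |>.1 h
  exact ⟨y, LinearPMap.mem_deficiencySpace.2 hy, rfl⟩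

end SimpleGraph

/-! ### The radial recursion and its growth. -/

/-- The radial solution of the eigenvalue equation on an antitree with sphere sizes `s`, multiplied
by the sphere sizes. -/
noncomputable def radialSolution (s : ℕ → ℕ) (z : ℂ) : ℕ → ℂ
  | 0 => 1
  | 1 => z
  | n + 2 => z / s (n + 1) * radialSolution s z (n + 1) - radialSolution s z n

theorem im_le_norm_radialSolution_mul (s : ℕ → ℕ) (z : ℂ) (n : ℕ) :
    |z.im| ≤ ‖radialSolution s z n‖ * ‖radialSolution s z (n + 1)‖ := by
  have key : ∀ n, ∃ c : ℝ, 1 ≤ c ∧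
      ((starRingEnd ℂ) (radialSolution s z n) * radialSolution s z (n + 1)).im = c * z.im := by
    intro n
    induction n with
    | zero => exact ⟨1, le_rfl, by simp [radialSolution]⟩
    | succ n ih =>
      obtain ⟨c, hc, h⟩ := ih
      -- The recursion adds `|pₙ₊₁|² / sₙ₊₁` to the coefficient of `Im z`, so it never drops below
      -- its initial value 1.
      refine ⟨c + (s (n + 1) : ℝ)⁻¹ * Complex.normSq (radialSolution s z (n + 1)), ?_, ?_⟩
      · have : 0 ≤ (s (n + 1) : ℝ)⁻¹ * Complex.normSq (radialSolution s z (n + 1)) :=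
          mul_nonneg (by positivity) (Complex.normSq_nonneg _)
        linarith
      · have h2 : (starRingEnd ℂ) (radialSolution s z (n + 1)) * radialSolution s z (n + 1 + 1) =
            (((s (n + 1) : ℝ)⁻¹ * Complex.normSq (radialSolution s z (n + 1)) : ℝ) : ℂ) * z -
            (starRingEnd ℂ) ((starRingEnd ℂ) (radialSolution s z n) *
              radialSolution s z (n + 1)) := by
          rw [radialSolution]
          push_cast
          rw [Complex.normSq_eq_conj_mul_self, map_mul, Complex.conj_conj]
          ring
        rw [h2, Complex.sub_im, Complex.conj_im, h, Complex.im_ofReal_mul]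
        ring
  obtain ⟨c, hc, h⟩ := key n
  calc |z.im| ≤ |c * z.im| := by
        rw [abs_mul]
        exact le_mul_of_one_le_left (abs_nonneg _) (hc.trans (le_abs_self c))
    _ ≤ ‖(starRingEnd ℂ) (radialSolution s z n) * radialSolution s z (n + 1)‖ :=
        h ▸ Complex.abs_im_le_norm _
    _ = _ := by rw [norm_mul, Complex.norm_conj]

/-- Adding consecutive terms, `|pₙ|² + |pₙ₊₁|² ≥ 2 |Im z|`, while both denominators are at most `n +
2`. -/
theorem not_summable_radialSolution {s : ℕ → ℕ} (hs : ∀ n, s n ≤ n + 1) (hpos : ∀ n, 0 < s n)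
    {z : ℂ} (hz : z.im ≠ 0) : ¬ Summable fun n => ‖radialSolution s z n‖ ^ 2 / s n := by
  intro h
  have h2 := h.add ((summable_nat_add_iff 1).2 h)
  have hc : 0 < |z.im| := abs_pos.2 hz
  have h3 : Summable fun n : ℕ => |z.im| * (1 / ((n + 2 : ℕ) : ℝ)) := by
    refine h2.of_nonneg_of_le (fun n => by positivity) fun n => ?_
    have hdiv : ∀ (a : ℝ) (k : ℕ), 0 ≤ a → 0 < k → k ≤ n + 2 →
        a / ((n + 2 : ℕ) : ℝ) ≤ a / k := fun a k ha hk hkn =>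
      div_le_div_of_nonneg_left ha (by exact_mod_cast hk) (by exact_mod_cast hkn)
    have e1 := hdiv (‖radialSolution s z n‖ ^ 2) (s n) (by positivity) (hpos n)
      ((hs n).trans (by omega))
    have e2 := hdiv (‖radialSolution s z (n + 1)‖ ^ 2) (s (n + 1)) (by positivity) (hpos _) (hs _)
    refine le_trans ?_ (add_le_add e1 e2)
    rw [mul_one_div, ← add_div]
    gcongr
    nlinarith [im_le_norm_radialSolution_mul s z n,
      sq_nonneg (‖radialSolution s z n‖ - ‖radialSolution s z (n + 1)‖)]
  rw [summable_mul_left_iff hc.ne', summable_nat_add_iff (f := fun n : ℕ => 1 / (n : ℝ)) 2] at h3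
  exact Real.not_summable_one_div_natCast h3

/-- A discrete Grönwall argument: each step enlarges the maximum of two consecutive norms by a
factor of at most `1 + |z| / sₙ₊₁`, and the product of these factors converges. -/
theorem exists_norm_radialSolution_le {s : ℕ → ℕ} {z : ℂ}
    (hs : Summable fun n => (1 : ℝ) / s n) : ∃ C, ∀ n, ‖radialSolution s z n‖ ≤ C := by
  let a : ℕ → ℝ := fun n => ‖z‖ * (1 / s n)
  have ha : ∀ n, 0 ≤ a n := fun n => by positivity
  have hsum : Summable a := hs.mul_left _
  let M : ℝ := max 1 ‖z‖
  have hM : 0 ≤ M := zero_le_one.trans (le_max_left _ _)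
  have key : ∀ n, max ‖radialSolution s z n‖ ‖radialSolution s z (n + 1)‖ ≤
      M * ∏ k ∈ Finset.range (n + 1), (1 + a k) := by
    intro n
    induction n with
    | zero =>
      simp only [radialSolution, norm_one, zero_add, Finset.prod_range_one]
      exact le_mul_of_one_le_right hM (by linarith [ha 0])
    | succ n ih =>
      rw [Finset.prod_range_succ, ← mul_assoc]
      set B := M * ∏ k ∈ Finset.range (n + 1), (1 + a k)
      obtain ⟨h1, h2⟩ := max_le_iff.1 ih
      have hB : 0 ≤ B := (norm_nonneg _).trans h1
      have h3 := mul_le_mul_of_nonneg_left h2 (ha (n + 1))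
      refine max_le ?_ ?_
      · nlinarith [mul_nonneg hB (ha (n + 1))]
      · rw [radialSolution]
        refine (norm_sub_le _ _).trans ?_
        have : ‖z / s (n + 1) * radialSolution s z (n + 1)‖ =
            a (n + 1) * ‖radialSolution s z (n + 1)‖ := by
          simp [a, div_eq_mul_inv]
        rw [this]
        linarith
  refine ⟨M * Real.exp (∑' n, a n), fun n => ?_⟩
  refine (le_max_left _ _).trans ((key n).trans ?_)
  gcongr
  refine (Real.prod_one_add_le_exp_sum _ ha).trans ?_
  gcongr
  exact hsum.sum_le_tsum _ fun k _ => ha k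

theorem summable_radialSolution {s : ℕ → ℕ} {z : ℂ} (hs : Summable fun n => (1 : ℝ) / s n) :
    Summable fun n => ‖radialSolution s z n‖ ^ 2 / s n := by
  obtain ⟨C, hC⟩ := exists_norm_radialSolution_le (z := z) hs
  refine (hs.mul_left (C ^ 2)).of_nonneg_of_le (fun n => by positivity) fun n => ?_
  rw [mul_one_div]
  gcongr
  exact hC n

/-! ### Size estimates for the spheres. -/

theorem powerSphereSize_pos {α : ℝ} (hα : 0 < α) (n : ℕ) : 0 < powerSphereSize α n := by
  rw [powerSphereSize]
  split_ifs with h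
  · exact one_pos
  · exact Nat.floor_pos.2 (Real.one_le_rpow (by exact_mod_cast Nat.one_le_iff_ne_zero.2 h) hα.le)

theorem powerSphereSize_le {α : ℝ} (hα : α ≤ 1) (n : ℕ) : powerSphereSize α n ≤ n + 1 := by
  rw [powerSphereSize]
  split_ifs with h
  · omega
  · refine (Nat.floor_le_of_le ?_).trans n.le_succ
    have h1 : (1 : ℝ) ≤ n := by exact_mod_cast Nat.one_le_iff_ne_zero.2 h
    simpa using Real.rpow_le_rpow_of_exponent_le h1 hα

theorem summable_one_div_powerSphereSize {α : ℝ} (hα : 1 < α) :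
    Summable fun n => (1 : ℝ) / powerSphereSize α n := by
  rw [← summable_nat_add_iff 1]
  have h := (summable_nat_add_iff 1).2 (Real.summable_one_div_nat_rpow.2 hα)
  refine (h.mul_left 2).of_nonneg_of_le (fun n => by positivity) fun n => ?_
  have h1 : (1 : ℝ) ≤ ((n + 1 : ℕ) : ℝ) ^ α :=
    Real.one_le_rpow (by simp) (zero_le_one.trans hα.le)
  -- For `t ≥ 1`, `t < ⌊t⌋ + 1 ≤ 2⌊t⌋`.
  have h2 : (((n + 1 : ℕ) : ℝ) ^ α) / 2 ≤ powerSphereSize α (n + 1) := by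
    rw [powerSphereSize, if_neg n.succ_ne_zero]
    have := Nat.lt_floor_add_one (((n + 1 : ℕ) : ℝ) ^ α)
    have : (1 : ℝ) ≤ ⌊((n + 1 : ℕ) : ℝ) ^ α⌋₊ := by exact_mod_cast Nat.floor_pos.2 h1
    linarith
  refine (one_div_le_one_div_of_le (by positivity) h2).trans_eq ?_
  rw [one_div_div, mul_one_div]

/-! ### Eigenfunctions on antitrees and deficiency spaces. -/

namespace SimpleGraph

variable {V : Type*} {G : SimpleGraph V} {root : V} {s : ℕ → ℕ}

/-- The radial function on an antitree built from `radialSolution`. -/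
noncomputable def radialEigenfunction (G : SimpleGraph V) (root : V) (s : ℕ → ℕ) (z : ℂ) (x : V) :
    ℂ :=
  radialSolution s z (G.dist root x) / s (G.dist root x)

/-- The antitree condition says nothing at the root, but there adjacency already means distance 1.
Elsewhere the distance is positive, so the truncated `n - 1` is harmless. -/
theorem IsAntitree.adj_iff (hG : G.IsAntitree root) (x y : V) :
    G.Adj x y ↔ G.dist root x = G.dist root y + 1 ∨ G.dist root y = G.dist root x + 1 := by
  by_cases hx : x = root
  · subst hx
    rw [SimpleGraph.dist_self, ← dist_eq_one_iff_adj]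
    omega
  · have h := Set.ext_iff.1 (hG.neighborSet_eq x hx) y
    have h0 : G.dist root x ≠ 0 := fun h => hx ((hG.connected.dist_eq_zero_iff).1 h).symm
    simp only [mem_neighborSet, sphere, Set.mem_union, Set.mem_ofPred_eq] at h
    rw [h]
    omega

theorem card_sphere_toFinset (hs : ∀ n, (G.sphere root n).encard = (s n : ℕ∞)) (n : ℕ) :
    (Set.finite_of_encard_eq_coe (hs n)).toFinset.card = s n := by
  have h := (Set.finite_of_encard_eq_coe (hs n)).encard_eq_coe_toFinset_card
  rw [hs n] at h
  exact_mod_cast h.symm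

theorem IsAntitree.adjacencySum_eq [G.LocallyFinite] (hG : G.IsAntitree root)
    (hs : ∀ n, (G.sphere root n).encard = (s n : ℕ∞)) (f : V → ℂ) {x : V} {n : ℕ}
    (hx : G.dist root x = n + 1) :
    G.adjacencySum f x = ∑ y ∈ (Set.finite_of_encard_eq_coe (hs n)).toFinset, f y +
      ∑ y ∈ (Set.finite_of_encard_eq_coe (hs (n + 2))).toFinset, f y := by
  classical
  rw [adjacencySum, ← Finset.sum_union]
  · refine Finset.sum_congr ?_ fun _ _ => rfl
    ext y
    simp only [mem_neighborFinset, hG.adj_iff, hx, Finset.mem_union, Set.Finite.mem_toFinset,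
      sphere, Set.mem_ofPred_eq]
    omega
  · rw [Finset.disjoint_left]
    intro y h1 h2
    simp only [Set.Finite.mem_toFinset, sphere, Set.mem_ofPred_eq] at h1 h2
    omega

theorem IsAntitree.adjacencySum_root [G.LocallyFinite] (hG : G.IsAntitree root)
    (hs : ∀ n, (G.sphere root n).encard = (s n : ℕ∞)) (f : V → ℂ) :
    G.adjacencySum f root = ∑ y ∈ (Set.finite_of_encard_eq_coe (hs 1)).toFinset, f y := by
  refine Finset.sum_congr ?_ fun _ _ => rfl
  ext y
  simp only [mem_neighborFinset, hG.adj_iff, SimpleGraph.dist_self, Set.Finite.mem_toFinset,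
    sphere, Set.mem_ofPred_eq]
  omega

theorem sum_sphere_of_eq {f : V → ℂ} {n : ℕ} {c : ℂ}
    (hs : ∀ n, (G.sphere root n).encard = (s n : ℕ∞)) (h : ∀ x, G.dist root x = n → f x = c) :
    ∑ y ∈ (Set.finite_of_encard_eq_coe (hs n)).toFinset, f y = s n * c := by
  rw [Finset.sum_congr rfl fun y hy => h y (by simpa [sphere] using hy), Finset.sum_const,
    card_sphere_toFinset hs, nsmul_eq_mul]

theorem sum_sphere_zero (hG : G.IsAntitree root)
    (hs : ∀ n, (G.sphere root n).encard = (s n : ℕ∞)) (f : V → ℂ) :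
    ∑ y ∈ (Set.finite_of_encard_eq_coe (hs 0)).toFinset, f y = f root := by
  have h : (Set.finite_of_encard_eq_coe (hs 0)).toFinset = {root} := by
    ext y
    simp [sphere, hG.connected.dist_eq_zero_iff, eq_comm]
  rw [h, Finset.sum_singleton]

theorem IsAntitree.adjacencySum_radialEigenfunction [G.LocallyFinite] (hG : G.IsAntitree root)
    (hs : ∀ n, (G.sphere root n).encard = (s n : ℕ∞)) (hpos : ∀ n, 0 < s n) (h0 : s 0 = 1)
    (z : ℂ) (x : V) :
    G.adjacencySum (G.radialEigenfunction root s z) x = z * G.radialEigenfunction root s z x := by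
  have hsum : ∀ n, ∑ y ∈ (Set.finite_of_encard_eq_coe (hs n)).toFinset,
      G.radialEigenfunction root s z y = radialSolution s z n := by
    intro n
    rw [sum_sphere_of_eq hs (c := radialSolution s z n / s n)
      fun x hx => by rw [radialEigenfunction, hx]]
    exact mul_div_cancel₀ _ (by exact_mod_cast (hpos n).ne')
  rcases hx : G.dist root x with _ | n
  · obtain rfl := hG.connected.dist_eq_zero_iff.1 hx
    rw [hG.adjacencySum_root hs, hsum, radialEigenfunction, hx, h0]
    simp [radialSolution]
  · rw [hG.adjacencySum_eq hs _ hx, hsum, hsum, radialEigenfunction, hx, radialSolution]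
    ring

/-- Eigenfunctions of an antitree for nonzero eigenvalues are radial. -/
theorem IsAntitree.eq_smul_radialEigenfunction [G.LocallyFinite] (hG : G.IsAntitree root)
    (hs : ∀ n, (G.sphere root n).encard = (s n : ℕ∞)) (hpos : ∀ n, 0 < s n) (h0 : s 0 = 1)
    {z : ℂ} (hz : z ≠ 0) {f : V → ℂ} (hf : ∀ x, G.adjacencySum f x = z * f x) (x : V) :
    f x = f root * G.radialEigenfunction root s z x := by
  set σ : ℕ → ℂ := fun n => ∑ y ∈ (Set.finite_of_encard_eq_coe (hs n)).toFinset, f y with hσ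
  have hs0 : ∀ n, (s n : ℂ) ≠ 0 := fun n => by exact_mod_cast (hpos n).ne'
  have hσ0 : σ 0 = f root := sum_sphere_zero hG hs f
  have hσ1 : σ 1 = z * f root := by rw [← hf, hG.adjacencySum_root hs]
  -- Since `z ≠ 0`, the eigenvalue equation expresses `f x` through the two adjacent sphere sums
  -- alone, so `f` is radial.
  have hfx : ∀ n x, G.dist root x = n + 1 → f x = (σ n + σ (n + 2)) / z := by
    intro n x hx
    rw [eq_div_iff hz, mul_comm, ← hf, hG.adjacencySum_eq hs f hx]
  have hσs : ∀ n, σ (n + 1) = s (n + 1) * ((σ n + σ (n + 2)) / z) := fun n =>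
    sum_sphere_of_eq hs (hfx n)
  have hrad : ∀ n, σ n = f root * radialSolution s z n ∧
      σ (n + 1) = f root * radialSolution s z (n + 1) := by
    intro n
    induction n with
    | zero => exact ⟨by simp [hσ0, radialSolution], by simp [hσ1, radialSolution, mul_comm]⟩
    | succ n ih =>
      refine ⟨ih.2, ?_⟩
      -- Summing over a sphere and solving for the outer sum gives the recursion of
      -- `radialSolution`.
      have h1 : σ (n + 2) = z / s (n + 1) * σ (n + 1) - σ n := by
        rw [hσs n]
        field_simp [hs0 (n + 1)]
        ring
      rw [h1, ih.1, ih.2, radialSolution]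
      ring
  rcases hx : G.dist root x with _ | n
  · obtain rfl := hG.connected.dist_eq_zero_iff.1 hx
    simp [radialEigenfunction, radialSolution, h0]
  · rw [radialEigenfunction, hx, mul_div_assoc', ← (hrad (n + 1)).1, hσs n, hfx n x hx,
      mul_div_cancel_left₀ _ (hs0 _)]

/-- Sphere `n` has `s n` vertices, each contributing `|pₙ / sₙ|²`. -/
theorem summable_radialEigenfunction_iff
    (hs : ∀ n, (G.sphere root n).encard = (s n : ℕ∞)) (hpos : ∀ n, 0 < s n) (z : ℂ) :
    Summable (fun x => ‖G.radialEigenfunction root s z x‖ ^ 2) ↔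
      Summable fun n => ‖radialSolution s z n‖ ^ 2 / s n := by
  have hfin : ∀ n, Finite {x // G.dist root x = n} := fun n =>
    (Set.finite_of_encard_eq_coe (hs n)).to_subtype
  have hcard : ∀ n, Nat.card {x // G.dist root x = n} = s n := fun n => by
    have h : (G.sphere root n).ncard = s n := by rw [Set.ncard_def, hs n]; rfl
    exact h
  rw [← (Equiv.sigmaFiberEquiv (G.dist root)).summable_iff,
    summable_sigma_of_nonneg (fun _ => by dsimp only [Function.comp]; positivity)]
  have hval : ∀ n, (fun x : {x // G.dist root x = n} =>
      ((fun x => ‖G.radialEigenfunction root s z x‖ ^ 2) ∘ Equiv.sigmaFiberEquiv (G.dist root))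
        ⟨n, x⟩) = fun _ => (‖radialSolution s z n‖ / s n) ^ 2 := by
    rintro n
    funext ⟨x, hx⟩
    simp [radialEigenfunction, Equiv.sigmaFiberEquiv, hx]
  simp only [hval]
  have hterm : ∀ n, ∑' _ : {x // G.dist root x = n}, (‖radialSolution s z n‖ / s n) ^ 2 =
      ‖radialSolution s z n‖ ^ 2 / s n := by
    intro n
    have : (s n : ℝ) ≠ 0 := by exact_mod_cast (hpos n).ne'
    rw [tsum_const, hcard, nsmul_eq_mul]
    field_simp
  simp only [hterm]
  exact and_iff_right fun n => Summable.of_finite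

theorem memℓp_two_iff {f : V → ℂ} : Memℓp f 2 ↔ Summable fun x => ‖f x‖ ^ 2 := by
  rw [memℓp_gen_iff (by norm_num)]
  simp

variable [G.LocallyFinite]

theorem IsAntitree.deficiencySpace_eq_bot (hG : G.IsAntitree root)
    (hs : ∀ n, (G.sphere root n).encard = (s n : ℕ∞)) (hpos : ∀ n, 0 < s n) (h0 : s 0 = 1)
    {z : ℂ} (hz : z ≠ 0) (h : ¬ Summable fun n => ‖radialSolution s z n‖ ^ 2 / s n) :
    G.adjacencyOperator.deficiencySpace z = ⊥ := by
  rw [Submodule.eq_bot_iff]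
  intro y hy
  have hy' := hG.eq_smul_radialEigenfunction hs hpos h0 hz
    (G.adjacencySum_eq_of_mem_deficiencySpace hy)
  have hroot : (y : lp (fun _ : V => ℂ) 2) root = 0 := by
    by_contra hne
    refine h ((summable_radialEigenfunction_iff hs hpos z).1 ?_)
    have hsum := memℓp_two_iff.1 (lp.memℓp (y : lp (fun _ : V => ℂ) 2))
    rw [funext fun x => (congrArg (‖·‖ ^ 2) (hy' x)).trans (by rw [norm_mul, mul_pow])] at hsum
    exact (summable_mul_left_iff (by positivity)).1 hsum
  ext x
  rw [hy', hroot, zero_mul]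
  rfl

theorem IsAntitree.rank_deficiencySpace_eq_one (hG : G.IsAntitree root)
    (hs : ∀ n, (G.sphere root n).encard = (s n : ℕ∞)) (hpos : ∀ n, 0 < s n) (h0 : s 0 = 1)
    {z : ℂ} (hz : z ≠ 0) (h : Summable fun n => ‖radialSolution s z n‖ ^ 2 / s n) :
    Module.rank ℂ (G.adjacencyOperator.deficiencySpace z) = 1 := by
  let φ : lp (fun _ : V => ℂ) 2 := ⟨G.radialEigenfunction root s z,
    memℓp_two_iff.2 ((summable_radialEigenfunction_iff hs hpos z).2 h)⟩
  obtain ⟨y, hy, hyφ⟩ := G.exists_mem_deficiencySpace (f := φ)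
    (hG.adjacencySum_radialEigenfunction hs hpos h0 z)
  rw [rank_eq_one_iff]
  -- The radial eigenfunction equals 1 at the root, so it is nonzero and the coefficient of any `w`
  -- along it is the value of `w` at the root.
  refine ⟨⟨y, hy⟩, fun h => ?_, fun w => ⟨(w.1 : lp (fun _ : V => ℂ) 2) root, ?_⟩⟩
  · have hy0 : y = 0 := congrArg Subtype.val h
    have hφ : φ root = 0 := by rw [← hyφ, hy0]; rfl
    have : G.radialEigenfunction root s z root = 0 := hφ
    simp [radialEigenfunction, radialSolution, h0] at this
  · ext x
    have hw := hG.eq_smul_radialEigenfunction hs hpos h0 hz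
      (G.adjacencySum_eq_of_mem_deficiencySpace w.2) x
    rw [hw]
    change _ * (y : lp (fun _ : V => ℂ) 2) x = _
    rw [hyφ]

end SimpleGraph

theorem proposition2 (α : ℝ) (hα : 0 < α) {V : Type*} (G : SimpleGraph V) [G.LocallyFinite]
    (root : V) (hG : G.IsAntitree root)
    (hs : ∀ n : ℕ, (G.sphere root n).encard = (powerSphereSize α n : ℕ∞)) :
    (α ≤ 1 → G.adjacencyOperator.HasDeficiencyIndex 0 ∧
      G.adjacencyOperatorCore.IsEssentiallySelfAdjoint) ∧
    (1 < α → G.adjacencyOperator.HasDeficiencyIndex 1) := by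
  have hpos := powerSphereSize_pos hα
  have h0 : powerSphereSize α 0 = 1 := if_pos rfl
  refine ⟨fun h1 => ?_, fun h1 => ?_⟩
  · have hp : G.adjacencyOperator.deficiencySpace Complex.I = ⊥ :=
      hG.deficiencySpace_eq_bot hs hpos h0 Complex.I_ne_zero
        (not_summable_radialSolution (powerSphereSize_le h1) hpos (by simp))
    have hm : G.adjacencyOperator.deficiencySpace (-Complex.I) = ⊥ :=
      hG.deficiencySpace_eq_bot hs hpos h0 (neg_ne_zero.2 Complex.I_ne_zero)
        (not_summable_radialSolution (powerSphereSize_le h1) hpos (by simp))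
    refine ⟨⟨?_, ?_⟩, G.adjacencyOperatorCore_isClosable, ?_⟩
    · rw [LinearPMap.deficiencyIndexPlus, hp, rank_bot, map_zero]
    · rw [LinearPMap.deficiencyIndexMinus, hm, rank_bot, map_zero]
    · exact LinearPMap.isSelfAdjoint_of_deficiencySpace_eq_bot G.dense_adjacencyOperator_domain
        G.adjacencyOperatorCore_isClosable.closure_isClosed G.adjacencyOperator_isFormalAdjoint hp hm
  · have hsum := fun z => summable_radialSolution (z := z) (summable_one_div_powerSphereSize h1)
    constructor
    · rw [LinearPMap.deficiencyIndexPlus,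
        hG.rank_deficiencySpace_eq_one hs hpos h0 Complex.I_ne_zero (hsum _), map_one]
    · rw [LinearPMap.deficiencyIndexMinus,
        hG.rank_deficiencySpace_eq_one hs hpos h0 (neg_ne_zero.2 Complex.I_ne_zero) (hsum _),
        map_one]
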